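/- Let $K$ be a field with algebraic closure $\overline K$, let $d\ge 2$, and let $\phi=[F_1:G_1]\colon\mathbb P^1\to\mathbb P^1$ be a rational map of degree $d$ defined over $K$, where $F_1,G_1\in K[x,y]$ are homogeneous of degree $d$ without a common zero in $\mathbb P^1(\overline K)$. Let $h\in \mathrm{PGL}_2(K)$ be an automorphism of $\phi$ (that is, $h^{-1}\circ\phi\circ h=\phi$) of prime order $p$, and assume that the points of $\mathrm{Fix}(h)=\{P\in\mathbb P^1(\overline K): h(P)=P\}$ are all defined over $K$. Write $\phi^N=[F_N:G_N]$ for the $N$-th iterate, where $F_{N+1}(x,y)=F_N(F_1(x,y),G_1(x,y))$ and $G_{N+1}(x,y)=G_N(F_1(x,y),G_1(x,y))$. For $h^j=[a_jx+b_jy:c_jx+d_jy]$ put $$\Psi_{pN}=\prod_{j=1}^{p-1}\bigl((c_jx+d_jy)F_N-(a_jx+b_jy)G_N\bigr),\qquad \Psi^*_{pN}=\prod_{k\mid N,\ pk\nmid N}\Psi_{pk}^{\,\mu(N/k)},$$ $$\widetilde{\Psi^*_{pN}}=\frac{\Psi^*_{pN}}{\prod_{P=[x_P:y_P]\in \mathrm{Fix}(h)}(y_Px-x_Py)^{\delta_P}},\qquad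 \delta_P=\mathrm{ord}_{(y_Px-x_Py)}\Psi^*_{pN}.$$ These are defined up to nonzero constant factors. A point $Q\in\mathbb P^1(\overline K)$ has $h$-period $N$ for $\phi$ if $\phi^N(Q)=h^j(Q)$ for some $j>0$ with $p\nmid j$; it has primitive $h$-period $N$ if $N$ is the smallest positive integer with this property. Then: (a) for every prime $\ell$ the rational function $\widetilde{\Psi^*_{p\ell}}$ is a polynomial in $K[x,y]$, and there are at most $d+6$ primes $\ell$ for which it is trivial (that is, constant); (b) for all primes $\ell$ with at most $d+6$ exceptions, $\phi$ has a point $Q\in\mathbb P^1(\overline K)$ of primitive $h$-period $\ell$. -/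

import Mathlib

open MvPolynomial
open scoped LinearAlgebra.Projectivization MatrixGroups

noncomputable section

namespace HTuned

/-- The points of the projective line over a field `L`; the class of `v` is `[x : y]` with
`x = v 0`, `y = v 1`. -/
abbrev P1 (L : Type*) [Field L] : Type _ := ℙ L (Fin 2 → L)

theorem aeval_smul_of_isHomogeneous {K L : Type*} [Field K] [Field L] [Algebra K L]
    {F : MvPolynomial (Fin 2) K} {d : ℕ} (hF : F.IsHomogeneous d) (t : L) (v : Fin 2 → L) :
    aeval (t • v) F = t ^ d * aeval v F := by
  rw [aeval_def, aeval_def, eval₂_eq, eval₂_eq, Finset.mul_sum]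
  refine Finset.sum_congr rfl fun m hm => ?_
  have h1 : ∑ i ∈ m.support, m i = d := by
    have := hF (mem_support_iff.mp hm)
    simpa [Finsupp.weight_apply, Finsupp.sum] using this
  have h2 : ∏ i ∈ m.support, (t • v) i ^ m i = t ^ d * ∏ i ∈ m.support, v i ^ m i := by
    simp only [Pi.smul_apply, smul_eq_mul, mul_pow, Finset.prod_mul_distrib,
      Finset.prod_pow_eq_pow_sum, h1]
  rw [h2]
  ring

/-- A rational map `φ = [F : G]` of degree `d` from the projective line to itself, defined over
`K`: two binary forms `F = form 0`, `G = form 1` of degree `d` over `K` without a common zero in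
the projective line over the algebraic closure of `K`. -/
structure RationalMap (K : Type*) [Field K] (d : ℕ) where
  form : Fin 2 → MvPolynomial (Fin 2) K
  isHomogeneous : ∀ i, (form i).IsHomogeneous d
  no_common_zero : ∀ v : Fin 2 → AlgebraicClosure K, v ≠ 0 → ∃ i, aeval v (form i) ≠ 0

/-- The map induced by `φ` on the points of the projective line over the algebraic closure. -/
def RationalMap.toFun {K : Type*} [Field K] {d : ℕ} (φ : RationalMap K d) :
    P1 (AlgebraicClosure K) → P1 (AlgebraicClosure K) :=
  Projectivization.lift
    (fun v => Projectivization.mk (AlgebraicClosure K)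
      (fun i => aeval (v : Fin 2 → AlgebraicClosure K) (φ.form i))
      (by
        obtain ⟨i, hi⟩ := φ.no_common_zero v v.2
        exact fun h0 => hi (congrFun h0 i)))
    (by
      rintro ⟨a, ha⟩ ⟨b, hb⟩ t (rfl : a = t • b)
      rw [Projectivization.mk_eq_mk_iff']
      refine ⟨t ^ d, ?_⟩
      funext i
      simp [aeval_smul_of_isHomogeneous (φ.isHomogeneous i)])

/-- The forms `F_N, G_N` of the iterate `φ^N`: `F_{N+1}(x,y) = F_N(F_1(x,y), G_1(x,y))`, and
likewise for `G`. -/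
def RationalMap.iterForm {K : Type*} [Field K] {d : ℕ} (φ : RationalMap K d) :
    ℕ → Fin 2 → MvPolynomial (Fin 2) K
  | 0 => fun i => X i
  | N + 1 => fun i => bind₁ φ.form (RationalMap.iterForm φ N i)

/-- The linear forms `ax + by`, `cx + dy` of the Moebius transformation with matrix
`!![a, b; c, d]`. -/
def mobiusForm {K : Type*} [Field K] (h : GL (Fin 2) K) : Fin 2 → MvPolynomial (Fin 2) K :=
  fun i => ∑ j, C ((h : Matrix (Fin 2) (Fin 2) K) i j) * X j

/-- The forms of the conjugate `φ^h = h⁻¹ ∘ φ ∘ h`. -/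
def RationalMap.conjForm {K : Type*} [Field K] {d : ℕ} (φ : RationalMap K d) (h : GL (Fin 2) K) :
    Fin 2 → MvPolynomial (Fin 2) K :=
  fun i => ∑ j, C (((h⁻¹ : GL (Fin 2) K) : Matrix (Fin 2) (Fin 2) K) i j) *
    bind₁ (mobiusForm h) (φ.form j)

/-- `h` is an automorphism of `φ`: the rational maps `φ^h` and `φ` are equal, that is, their
forms agree up to a common nonzero scalar. -/
def RationalMap.IsAutomorphism {K : Type*} [Field K] {d : ℕ} (φ : RationalMap K d)
    (h : GL (Fin 2) K) : Prop :=
  ∃ c : K, c ≠ 0 ∧ ∀ i, φ.conjForm h i = C c * φ.form i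

/-- The class of `h` in the projective linear group over the algebraic closure, which acts on the
points of the projective line. -/
def toPGL {K : Type*} [Field K] (h : GL (Fin 2) K) : PGL(2, AlgebraicClosure K) :=
  Matrix.ProjGenLinGroup.mk (h.map (algebraMap K (AlgebraicClosure K)))

/-- All fixed points of `h` in the projective line over the algebraic closure are defined
over `K`. -/
def FixedPointsRational {K : Type*} [Field K] (h : GL (Fin 2) K) : Prop :=
  ∀ Q : P1 (AlgebraicClosure K), toPGL h • Q = Q →
    ∃ (v : Fin 2 → K) (hv : (fun i => algebraMap K (AlgebraicClosure K) (v i)) ≠ 0),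
      Q = Projectivization.mk (AlgebraicClosure K) _ hv

/-- `Q` has `h`-period `N` for `φ`, where `h` has prime order `p`:
`φ^N(Q) = h^j(Q)` for some `j > 0` with `p ∤ j`. -/
def HasHPeriod {K : Type*} [Field K] {d : ℕ} (φ : RationalMap K d) (h : GL (Fin 2) K) (p : ℕ)
    (Q : P1 (AlgebraicClosure K)) (N : ℕ) : Prop :=
  ∃ j : ℕ, 0 < j ∧ ¬ p ∣ j ∧ φ.toFun^[N] Q = toPGL h ^ j • Q

/-- `Q` has primitive `h`-period `N` for `φ`: `N` is the smallest positive `h`-period of `Q`. -/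
def HasPrimitiveHPeriod {K : Type*} [Field K] {d : ℕ} (φ : RationalMap K d) (h : GL (Fin 2) K)
    (p : ℕ) (Q : P1 (AlgebraicClosure K)) (N : ℕ) : Prop :=
  IsLeast {n : ℕ | 0 < n ∧ HasHPeriod φ h p Q n} N

/-- The form `φ^N(x,y) - h(x,y) := (cx + dy) F_N(x,y) - (ax + by) G_N(x,y)`, for `h` with matrix
`!![a, b; c, d]`. -/
def diffForm {K : Type*} [Field K] {d : ℕ} (φ : RationalMap K d) (N : ℕ) (h : GL (Fin 2) K) :
    MvPolynomial (Fin 2) K :=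
  mobiusForm h 1 * φ.iterForm N 0 - mobiusForm h 0 * φ.iterForm N 1

/-- `Psi φ h p N` is the polynomial `Ψ_{pN} = ∏_{j=1}^{p-1} (φ^N - h^j)`. -/
def Psi {K : Type*} [Field K] {d : ℕ} (φ : RationalMap K d) (h : GL (Fin 2) K) (p N : ℕ) :
    MvPolynomial (Fin 2) K :=
  ∏ j ∈ Finset.Icc 1 (p - 1), diffForm φ N (h ^ j)

/-- `PsiStar φ h p N` is the rational function `Ψ*_{pN}`, the product of `Ψ_{pk} ^ μ(N/k)` over
all `k ∣ N` with `pk ∤ N`. -/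
def PsiStar {K : Type*} [Field K] {d : ℕ} (φ : RationalMap K d) (h : GL (Fin 2) K) (p N : ℕ) :
    FractionRing (MvPolynomial (Fin 2) K) :=
  ∏ k ∈ N.divisors with ¬ p * k ∣ N,
    algebraMap (MvPolynomial (Fin 2) K) (FractionRing (MvPolynomial (Fin 2) K)) (Psi φ h p k) ^
      ArithmeticFunction.moebius (N / k)

/-- The order of a rational function `f` along the irreducible polynomial `l`. -/
def ordAlong {K : Type*} [Field K] (l : MvPolynomial (Fin 2) K)
    (f : FractionRing (MvPolynomial (Fin 2) K)) : ℤ :=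
  (multiplicity l (IsFractionRing.num (MvPolynomial (Fin 2) K) f) : ℤ) -
    (multiplicity l (IsFractionRing.den (MvPolynomial (Fin 2) K) f : MvPolynomial (Fin 2) K) : ℤ)

/-- The linear form `y_P x - x_P y` vanishing at the point `P = [x_P : y_P]`. -/
def pointForm {K : Type*} [Field K] (P : P1 K) : MvPolynomial (Fin 2) K :=
  C (P.rep 1) * X 0 - C (P.rep 0) * X 1

/-- `PsiTilde φ h p N` is the `h`-tuned dynatomic polynomial: the rational function `Ψ*_{pN}`
divided by the product of `(y_P x - x_P y) ^ ord(Ψ*_{pN})` over the fixed points `P` of `h`. -/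
def PsiTilde {K : Type*} [Field K] {d : ℕ} (φ : RationalMap K d) (h : GL (Fin 2) K) (p N : ℕ) :
    FractionRing (MvPolynomial (Fin 2) K) :=
  PsiStar φ h p N /
    ∏ᶠ P ∈ {P : P1 K | (Matrix.ProjGenLinGroup.mk h : PGL(2, K)) • P = P},
      algebraMap (MvPolynomial (Fin 2) K) (FractionRing (MvPolynomial (Fin 2) K)) (pointForm P) ^
        ordAlong (pointForm P) (PsiStar φ h p N)

end HTuned

end

/-! Put `ψ = h⁻¹ ∘ φ`, again a map of degree `d`. Since `h` commutes with `φ`, `ψ^n = h⁻ⁿ ∘ φ^n`, so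
`φ^n(Q) = h^n(Q)` says that `Q` has period `n` for `ψ`. Everything reduces to finding points of
exact period `ℓ` for `ψ`.

For a map `f` of degree at least two, the period form `x ∧ f(x)` divides `x ∧ f^ℓ(x)`, and the
quotient has degree `d^ℓ - d > 0`, hence a zero. If this zero is a fixed point, scaled to a fixed
vector, the quotient there equals `1 + λ + ... + λ^(ℓ-1)` with `λ` the multiplier. Its vanishing
forces `ℓ` to be the characteristic or the order of `λ`, so each fixed point spoils at most one
further prime (`exists_finset_primes_exact_period`).

A point of exact period `ℓ ≠ p` for `ψ` has primitive `h`-period `ℓ`: a relation `φ^n(Q) = h^j(Q)`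
gives the `ψ`-period `np`, which is prime to `ℓ` when `n < ℓ` (`iterate_ne_pow_smul`). This is (b).

For (a), `φ - h^j` divides `φ^ℓ - h^(jℓ)`, and multiplication by `ℓ` permutes the nonzero residues
mod `p`, so `Ψ*` is a polynomial (`exists_mul_Psi_eq`); the linear forms removed at fixed points of
`h` are coprime divisors of it. If the result is constant, the point `Q` of (b) is a zero of the
removed factor, so `h` fixes `Q`, hence also `φ(Q)` and `φ²(Q)`. For `ℓ > 2` these are distinct, and
three fixed points make `h` trivial. -/

noncomputable section

namespace HTuned

/-! ### Homogeneous polynomial maps and divisibility of period forms. -/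

section Maps

variable {K : Type*} [Field K] {B : Type*} [CommRing B] [Algebra K B]

theorem aeval_smul_of_isHomogeneous_commRing {F : MvPolynomial (Fin 2) K} {d : ℕ}
    (hF : F.IsHomogeneous d) (t : B) (v : Fin 2 → B) :
    aeval (t • v) F = t ^ d * aeval v F := by
  rw [aeval_def, aeval_def, eval₂_eq, eval₂_eq, Finset.mul_sum]
  refine Finset.sum_congr rfl fun m hm => ?_
  have h1 : ∑ i ∈ m.support, m i = d := by
    have := hF (mem_support_iff.mp hm)
    simpa [Finsupp.weight_apply, Finsupp.sum] using this
  have h2 : ∏ i ∈ m.support, (t • v) i ^ m i = t ^ d * ∏ i ∈ m.support, v i ^ m i := by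
    simp only [Pi.smul_apply, smul_eq_mul, mul_pow, Finset.prod_mul_distrib,
      Finset.prod_pow_eq_pow_sum, h1]
  rw [h2]
  ring

/-- The value of the polynomial map `f` at the point `v` with coordinates in a `K`-algebra. -/
def evalMap (f : Fin 2 → MvPolynomial (Fin 2) K) (v : Fin 2 → B) : Fin 2 → B :=
  fun i => aeval v (f i)

/-- The determinant of two vectors, which vanishes when they are proportional. -/
def cross (v w : Fin 2 → B) : B := v 1 * w 0 - v 0 * w 1

theorem map_cross {B' : Type*} [CommRing B'] [Algebra K B'] (σ : B →ₐ[K] B') (v w : Fin 2 → B) :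
    σ (cross v w) = cross (fun i => σ (v i)) (fun i => σ (w i)) := by
  simp [cross]

theorem map_evalMap {B' : Type*} [CommRing B'] [Algebra K B'] (σ : B →ₐ[K] B')
    (f : Fin 2 → MvPolynomial (Fin 2) K) (v : Fin 2 → B) :
    (fun i => σ (evalMap f v i)) = evalMap f (fun i => σ (v i)) := by
  funext i
  exact (comp_aeval_apply v σ (f i))

theorem map_evalMap_iterate {B' : Type*} [CommRing B'] [Algebra K B'] (σ : B →ₐ[K] B')
    (f : Fin 2 → MvPolynomial (Fin 2) K) (n : ℕ) (v : Fin 2 → B) :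
    (fun i => σ ((evalMap f)^[n] v i)) = (evalMap f)^[n] (fun i => σ (v i)) := by
  induction n generalizing v with
  | zero => rfl
  | succ n ih => rw [Function.iterate_succ_apply, ih, map_evalMap, Function.iterate_succ_apply]

theorem aeval_evalMap_iterate_X (f : Fin 2 → MvPolynomial (Fin 2) K) (n : ℕ) (v : Fin 2 → B) :
    (fun i => aeval v ((evalMap f)^[n] (X : Fin 2 → MvPolynomial (Fin 2) K) i)) =
      (evalMap f)^[n] v := by
  rw [map_evalMap_iterate (aeval v)]
  simp

theorem aeval_cross_iterate_X (f : Fin 2 → MvPolynomial (Fin 2) K) (n : ℕ) (v : Fin 2 → B) :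
    aeval v (cross X ((evalMap f)^[n] (X : Fin 2 → MvPolynomial (Fin 2) K))) =
      cross v ((evalMap f)^[n] v) := by
  rw [map_cross (aeval v), aeval_evalMap_iterate_X]
  simp

theorem cross_self (v : Fin 2 → B) : cross v v = 0 := by
  rw [cross]; ring

theorem cross_smul_left (c : B) (v w : Fin 2 → B) : cross (c • v) w = c * cross v w := by
  simp only [cross, Pi.smul_apply, smul_eq_mul]; ring

theorem cross_smul_right (c : B) (v w : Fin 2 → B) : cross v (c • w) = c * cross v w := by
  simp only [cross, Pi.smul_apply, smul_eq_mul]; ring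

theorem smul_eq_smul_of_cross_eq_zero {v w : Fin 2 → B} (h : cross v w = 0) (i : Fin 2) :
    v i • w = w i • v := by
  rw [cross] at h
  funext k
  fin_cases i <;> fin_cases k <;> simp <;> first | ring | linear_combination h | linear_combination -h

theorem exists_smul_of_cross_eq_zero {L : Type*} [Field L] {v w : Fin 2 → L} (hv : v ≠ 0)
    (h : cross v w = 0) : ∃ c : L, w = c • v := by
  obtain ⟨i, hi⟩ := Function.ne_iff.mp hv
  refine ⟨w i / v i, ?_⟩
  have := smul_eq_smul_of_cross_eq_zero h i
  rw [div_eq_inv_mul, mul_smul, ← this, smul_smul, inv_mul_cancel₀ hi, one_smul]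

variable {f : Fin 2 → MvPolynomial (Fin 2) K} {d : ℕ}

theorem evalMap_smul (hf : ∀ i, (f i).IsHomogeneous d) (t : B) (v : Fin 2 → B) :
    evalMap f (t • v) = t ^ d • evalMap f v := by
  funext i
  simp [evalMap, aeval_smul_of_isHomogeneous_commRing (hf i)]

/-- A proportionality constant need not exist over a general ring such as the quotient by a period
form, so denominators are cleared by a power of a coordinate. -/
theorem exists_pow_smul_iterate_eq (hf : ∀ i, (f i).IsHomogeneous d) {v : Fin 2 → B}
    (h : cross v (evalMap f v) = 0) (i : Fin 2) (n : ℕ) :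
    ∃ (m : ℕ) (c : B), v i ^ m • (evalMap f)^[n] v = c • v := by
  induction n with
  | zero => exact ⟨0, 1, by simp⟩
  | succ n ih =>
    obtain ⟨m, c, hc⟩ := ih
    refine ⟨1 + m * d, c ^ d * evalMap f v i, ?_⟩
    have := congrArg (evalMap f) hc
    rw [evalMap_smul hf, evalMap_smul hf] at this
    rw [Function.iterate_succ_apply', pow_add, pow_one, mul_smul, pow_mul, this, smul_comm,
      smul_eq_smul_of_cross_eq_zero h, mul_smul]

/-- Powers of the two variables are coprime, so the gcd of the two multiples of `Q` is `Q` itself.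
This removes the coordinate powers introduced when clearing denominators. -/
theorem dvd_of_forall_dvd_X_pow_mul {P Q : MvPolynomial (Fin 2) K}
    (h : ∀ i : Fin 2, ∃ m : ℕ, P ∣ X i ^ m * Q) : P ∣ Q := by
  obtain ⟨m, hm⟩ := h 0
  obtain ⟨k, hk⟩ := h 1
  have hrel : IsRelPrime (X 0 ^ m : MvPolynomial (Fin 2) K) (X 1 ^ k) := by
    apply IsRelPrime.pow
    rw [(X_prime (R := K) (i := (0 : Fin 2))).irreducible.isRelPrime_iff_not_dvd, X_dvd_X]
    simp
  by_cases hQ : Q = 0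
  · simp [hQ]
  obtain ⟨g⟩ : Nonempty (NormalizedGCDMonoid (MvPolynomial (Fin 2) K)) := inferInstance
  have h1 := dvd_gcd hm hk
  have h2 : Associated (gcd (X 0 ^ m * Q) (X 1 ^ k * Q)) Q := by
    refine (gcd_mul_right' Q _ _).trans ?_
    rw [← gcd_isUnit_iff_isRelPrime] at hrel
    exact (associated_unit_mul_left Q _ hrel)
  exact h1.trans h2.dvd

theorem cross_dvd_of_quotient {P : MvPolynomial (Fin 2) K} {v w : Fin 2 → MvPolynomial (Fin 2) K}
    (h : ∀ i : Fin 2, ∃ m : ℕ,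
      Ideal.Quotient.mkₐ K (Ideal.span {P}) (X i ^ m * cross v w) = 0) : P ∣ cross v w := by
  refine dvd_of_forall_dvd_X_pow_mul fun i => ?_
  obtain ⟨m, hm⟩ := h i
  refine ⟨m, ?_⟩
  rw [Ideal.Quotient.mkₐ_eq_mk, Ideal.Quotient.eq_zero_iff_mem, Ideal.mem_span_singleton] at hm
  exact hm

theorem cross_evalMap_dvd_cross_iterate (hf : ∀ i, (f i).IsHomogeneous d) (n : ℕ) :
    cross X (evalMap f (X : Fin 2 → MvPolynomial (Fin 2) K)) ∣
      cross X ((evalMap f)^[n] (X : Fin 2 → MvPolynomial (Fin 2) K)) := by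
  refine cross_dvd_of_quotient fun i => ?_
  set P := cross X (evalMap f (X : Fin 2 → MvPolynomial (Fin 2) K)) with hP
  set σ := Ideal.Quotient.mkₐ K (Ideal.span {P})
  have h0 : cross (fun i => σ (X i)) (evalMap f (fun i => σ (X i))) = 0 := by
    rw [← map_evalMap, ← map_cross, ← hP]
    exact Ideal.Quotient.eq_zero_iff_mem.mpr (Ideal.mem_span_singleton_self P)
  obtain ⟨m, c, hc⟩ := exists_pow_smul_iterate_eq hf h0 i n
  refine ⟨m, ?_⟩
  rw [map_mul, map_pow, map_cross, map_evalMap_iterate, ← cross_smul_right, hc, cross_smul_right,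
    cross_self, mul_zero]

theorem cross_evalMap_dvd_cross_evalMap_evalMap (hf : ∀ i, (f i).IsHomogeneous d) :
    cross X (evalMap f (X : Fin 2 → MvPolynomial (Fin 2) K)) ∣
      cross (evalMap f X) (evalMap f (evalMap f (X : Fin 2 → MvPolynomial (Fin 2) K))) := by
  refine cross_dvd_of_quotient fun i => ⟨d, ?_⟩
  set P := cross X (evalMap f (X : Fin 2 → MvPolynomial (Fin 2) K)) with hP
  set σ := Ideal.Quotient.mkₐ K (Ideal.span {P})
  have h0 : cross (fun i => σ (X i)) (evalMap f (fun i => σ (X i))) = 0 := by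
    rw [← map_evalMap, ← map_cross, ← hP]
    exact Ideal.Quotient.eq_zero_iff_mem.mpr (Ideal.mem_span_singleton_self P)
  rw [map_mul, map_pow, map_cross, map_evalMap, map_evalMap, map_evalMap, ← cross_smul_right,
    ← evalMap_smul hf, smul_eq_smul_of_cross_eq_zero h0, evalMap_smul hf, cross_smul_right,
    cross_self, mul_zero]

/-- A cofactor of one form in another scales like a form. The scaling law is proved with an
indeterminate scalar, where the other factor can be cancelled, and then specialised. -/
theorem aeval_smul_of_mul_isHomogeneous {A P : MvPolynomial (Fin 2) K} {m n : ℕ} (hmn : m ≤ n)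
    (hP : P.IsHomogeneous m) (hP0 : P ≠ 0) (hAP : (A * P).IsHomogeneous n) (t : B)
    (w : Fin 2 → B) : aeval (t • w) A = t ^ (n - m) * aeval w A := by
  let x : Fin 2 → Polynomial (MvPolynomial (Fin 2) K) := fun i => Polynomial.C (X i)
  have hx : ∀ F : MvPolynomial (Fin 2) K, aeval x F = Polynomial.C F := by
    intro F
    have := comp_aeval_apply (X : Fin 2 → MvPolynomial (Fin 2) K)
      (Polynomial.CAlgHom (R := K) (A := MvPolynomial (Fin 2) K)) F
    simpa [x] using this.symm
  have key : aeval ((Polynomial.X : Polynomial (MvPolynomial (Fin 2) K)) • x) A =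
      Polynomial.X ^ (n - m) * Polynomial.C A := by
    have h1 := aeval_smul_of_isHomogeneous_commRing hAP Polynomial.X x
    rw [map_mul, aeval_smul_of_isHomogeneous_commRing hP, hx, hx] at h1
    have hne : (Polynomial.X : Polynomial (MvPolynomial (Fin 2) K)) ^ m * Polynomial.C P ≠ 0 :=
      mul_ne_zero (pow_ne_zero _ Polynomial.X_ne_zero) (Polynomial.C_ne_zero.mpr hP0)
    refine mul_right_cancel₀ hne (h1.trans ?_)
    rw [map_mul]
    conv_lhs => rw [← Nat.sub_add_cancel hmn, pow_add]
    ring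
  let τ : Polynomial (MvPolynomial (Fin 2) K) →ₐ[K] B :=
    Polynomial.eval₂AlgHom (aeval w) t (fun a => Commute.all _ _)
  have h2 := congrArg τ key
  rw [comp_aeval_apply] at h2
  have h3 : (fun i => τ (((Polynomial.X : Polynomial (MvPolynomial (Fin 2) K)) • x) i)) = t • w := by
    funext i
    simpa [τ, x] using mul_comm _ _
  rw [h3] at h2
  rw [mul_comm]
  simpa [τ] using h2

end Maps

/-! ### Points of exact prime period over an algebraically closed field. -/

section Iterates

variable {L : Type*} [Field L] {f : Fin 2 → MvPolynomial (Fin 2) L} {d : ℕ}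

theorem evalMap_X (f : Fin 2 → MvPolynomial (Fin 2) L) : evalMap f X = f := by
  funext i
  simp [evalMap]

theorem isHomogeneous_evalMap_iterate_X (hf : ∀ i, (f i).IsHomogeneous d) (n : ℕ) (i : Fin 2) :
    ((evalMap f)^[n] (X : Fin 2 → MvPolynomial (Fin 2) L) i).IsHomogeneous (d ^ n) := by
  induction n generalizing i with
  | zero => simpa using isHomogeneous_X L i
  | succ n ih =>
    rw [Function.iterate_succ_apply', pow_succ]
    exact (hf i).aeval _ ih

theorem isHomogeneous_cross {v w : Fin 2 → MvPolynomial (Fin 2) L} {m n : ℕ}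
    (hv : ∀ i, (v i).IsHomogeneous m) (hw : ∀ i, (w i).IsHomogeneous n) :
    (cross v w).IsHomogeneous (m + n) :=
  ((hv 1).mul (hw 0)).sub ((hv 0).mul (hw 1))

/-- Nullstellensatz: if the origin were the only zero, `A` would divide a power of each variable and
so be a unit. -/
theorem exists_ne_zero_aeval_eq_zero [IsAlgClosed L] {A : MvPolynomial (Fin 2) L}
    (hA : aeval (0 : Fin 2 → L) A = 0) : ∃ v : Fin 2 → L, v ≠ 0 ∧ aeval v A = 0 := by
  by_contra! hne
  have hunit : IsUnit A := by
    rw [isUnit_iff_dvd_one]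
    refine dvd_of_forall_dvd_X_pow_mul fun i => ?_
    have hX : X i ∈ (Ideal.span {A}).radical := by
      rw [← vanishingIdeal_zeroLocus_eq_radical (K := L)]
      intro v hv
      have : v = 0 := by
        by_contra h0
        exact hne v h0 (hv A (Ideal.mem_span_singleton_self A))
      simp [this]
    obtain ⟨m, hm⟩ := hX
    exact ⟨m, by simpa using Ideal.mem_span_singleton.mp hm⟩
  exact (hunit.map (aeval (0 : Fin 2 → L))).ne_zero hA

/-- Otherwise `f` is the identity times a form `H` of degree `d - 1 ≥ 1`, whose nontrivial zero is a
common zero of `f`. -/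
theorem cross_X_ne_zero [IsAlgClosed L] (hd : 2 ≤ d) (hf : ∀ i, (f i).IsHomogeneous d)
    (hnz : ∀ v : Fin 2 → L, v ≠ 0 → evalMap f v ≠ 0) : cross X f ≠ 0 := by
  intro h
  rw [cross, sub_eq_zero] at h
  have hdvd : (X 0 : MvPolynomial (Fin 2) L) ∣ f 0 := by
    refine ((X_prime (R := L) (i := (0 : Fin 2))).dvd_or_dvd ⟨_, h⟩).resolve_left ?_
    rw [X_dvd_X]
    simp
  obtain ⟨H, hH⟩ := hdvd
  have hH1 : f 1 = X 1 * H := by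
    refine mul_left_cancel₀ (X_ne_zero (R := L) (0 : Fin 2)) ?_
    rw [← h, hH]
    ring
  have h0 := aeval_smul_of_mul_isHomogeneous (A := H) (m := 1) (n := d) (by omega) (isHomogeneous_X L (0 : Fin 2))
    (X_ne_zero _) (by rw [mul_comm, ← hH]; exact hf 0) (0 : L) 0
  rw [zero_smul, zero_pow (by omega), zero_mul] at h0
  obtain ⟨v, hv, hHv⟩ := exists_ne_zero_aeval_eq_zero h0
  refine hnz v hv ?_
  funext i
  have hev : eval v H = 0 := by simpa using hHv
  fin_cases i <;> simp [evalMap, hH, hH1, hev]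

theorem cross_smul_add_cross_smul {B : Type*} [CommRing B] (x a b : Fin 2 → B) :
    cross x a • b + cross a b • x = cross x b • a := by
  funext i
  fin_cases i <;> simp [cross] <;> ring

/-- If `A n` is the quotient of the `n`-th and the first period form of `f`, then at a fixed vector
its value is a geometric sum in the multiplier. -/
theorem aeval_quotient_eq_geom_sum {A : ℕ → MvPolynomial (Fin 2) L} {R : MvPolynomial (Fin 2) L}
    (hne : cross X f ≠ 0)
    (hA : ∀ n, cross X ((evalMap f)^[n] X) = A n * cross X f)
    (hR : cross f (evalMap f f) = R * cross X f)
    {v : Fin 2 → L} (hv : v ≠ 0) (hfv : evalMap f v = v) (n : ℕ) :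
    aeval v (A n) = ∑ i ∈ Finset.range n, aeval v R ^ i := by
  induction n with
  | zero =>
    have := hA 0
    rw [Function.iterate_zero_apply, cross_self, eq_comm, mul_eq_zero] at this
    simp [this.resolve_right hne]
  | succ n ih =>
    have hcomp : cross f ((evalMap f)^[n + 1] X) = aeval f (A n) * R * cross X f := by
      have h1 := congrArg (aeval f) (hA n)
      rw [aeval_cross_iterate_X, map_mul] at h1
      have h2 := aeval_cross_iterate_X f 1 f
      rw [Function.iterate_one, evalMap_X, hR] at h2
      rw [Function.iterate_succ_apply, evalMap_X, h1, h2, mul_assoc]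
    have hid := cross_smul_add_cross_smul X f ((evalMap f)^[n + 1] X)
    rw [hcomp, hA (n + 1)] at hid
    -- At the fixed vector this becomes the recursion `A (n+1) = 1 + A n * R`.
    have hid2 : ∀ i, (evalMap f)^[n + 1] X i + aeval f (A n) * R * X i = A (n + 1) * f i := by
      intro i
      refine mul_left_cancel₀ hne ?_
      have := congrFun hid i
      simp only [Pi.add_apply, Pi.smul_apply, smul_eq_mul] at this
      linear_combination this
    obtain ⟨i, hi⟩ := Function.ne_iff.mp hv
    have h3 := congrArg (aeval v) (hid2 i)
    have h4 := congrFun (aeval_evalMap_iterate_X f (n + 1) v) i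
    have h5 : (evalMap f)^[n + 1] v = v := Function.iterate_fixed hfv _
    have h6 : aeval v (aeval f (A n)) = aeval v (A n) := by
      rw [comp_aeval_apply]
      exact congrArg (fun u => aeval u (A n)) hfv
    have h7 : aeval v (f i) = v i := congrFun hfv i
    simp only [map_add, map_mul, aeval_X] at h3
    rw [h4, h5, h6, h7, ih] at h3
    refine mul_right_cancel₀ hi ?_
    rw [← h3, Finset.sum_range_succ', Finset.sum_congr rfl fun k _ => pow_succ (aeval v R) k,
      ← Finset.sum_mul]
    simp only [pow_zero]
    ring

theorem exists_finset_zeros [Infinite L] {P : MvPolynomial (Fin 2) L} {m : ℕ}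
    (hP : P.IsHomogeneous m) (hP0 : P ≠ 0) :
    ∃ S : Finset (Fin 2 → L), S.card ≤ m + 1 ∧
      ∀ v : Fin 2 → L, v ≠ 0 → aeval v P = 0 → ∃ s ∈ S, ∃ c : L, c ≠ 0 ∧ v = c • s := by
  classical
  let q : Polynomial L := aeval ![Polynomial.X, 1] P
  have hq : ∀ t : L, q.eval t = aeval ![t, 1] P := by
    intro t
    have := comp_aeval_apply ![Polynomial.X, 1] (Polynomial.aeval t) P
    rw [Polynomial.coe_aeval_eq_eval] at this
    rw [this]
    congr 2
    funext i
    fin_cases i <;> simp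
  have hscale : ∀ v : Fin 2 → L, v 1 ≠ 0 → v = v 1 • ![v 0 / v 1, 1] := by
    intro v hv
    funext i
    fin_cases i <;> simp
    field_simp
  have hq0 : q ≠ 0 := by
    intro h0
    have hXP : X 1 * P ≠ 0 := mul_ne_zero (X_ne_zero _) hP0
    refine hXP (MvPolynomial.funext fun v => ?_)
    by_cases hv : v 1 = 0
    · simp [hv]
    · have h1 := hq (v 0 / v 1)
      rw [h0, Polynomial.eval_zero] at h1
      have h2 : aeval v P = 0 := by
        rw [hscale v hv, aeval_smul_of_isHomogeneous_commRing hP, ← h1, mul_zero]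
      have hev : eval v P = 0 := by simpa using h2
      simp [hev]
  have hdeg : q.natDegree ≤ m := by
    have := aeval_natDegree_le P hP.totalDegree_le ![Polynomial.X, 1] (n := 1)
      (by intro i; fin_cases i <;> simp)
    simpa using this
  -- The point at infinity is always included, whence the bound `m + 1` instead of `m`.
  refine ⟨insert ![1, 0] (q.roots.toFinset.image fun t => ![t, 1]), ?_, ?_⟩
  · refine (Finset.card_insert_le _ _).trans (Nat.succ_le_succ ?_)
    exact Finset.card_image_le.trans
      ((Multiset.toFinset_card_le _).trans ((Polynomial.card_roots' q).trans hdeg))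
  · intro v hv hPv
    by_cases h1 : v 1 = 0
    · refine ⟨![1, 0], Finset.mem_insert_self _ _, v 0, ?_, ?_⟩
      · intro h0
        exact hv (by funext i; fin_cases i <;> simp [h0, h1])
      · funext i
        fin_cases i <;> simp [h1]
    · refine ⟨![v 0 / v 1, 1], Finset.mem_insert_of_mem (Finset.mem_image_of_mem _ ?_), v 1, h1,
        hscale v h1⟩
      rw [Multiset.mem_toFinset, Polynomial.mem_roots hq0, Polynomial.IsRoot, hq]
      rw [hscale v h1, aeval_smul_of_isHomogeneous_commRing hP] at hPv
      exact (mul_eq_zero.mp hPv).resolve_left (pow_ne_zero _ h1)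

theorem exists_smul_fixed [IsAlgClosed L] (hd : 2 ≤ d) (hf : ∀ i, (f i).IsHomogeneous d)
    {v : Fin 2 → L} (hv : v ≠ 0) (hfv : evalMap f v ≠ 0) (h : cross v (evalMap f v) = 0) :
    ∃ t : L, t ≠ 0 ∧ evalMap f (t • v) = t • v := by
  obtain ⟨c, hc⟩ := exists_smul_of_cross_eq_zero hv h
  have hc0 : c ≠ 0 := by
    rintro rfl
    exact hfv (by rw [hc, zero_smul])
  -- The vector `t • v` maps to `t ^ d * c` times `v`, so `t ^ (d - 1) = c⁻¹` is required.
  obtain ⟨t, ht⟩ := IsAlgClosed.exists_pow_nat_eq c⁻¹ (n := d - 1) (by omega)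
  have ht0 : t ≠ 0 := by
    rintro rfl
    rw [zero_pow (by omega)] at ht
    exact inv_ne_zero hc0 ht.symm
  refine ⟨t, ht0, ?_⟩
  rw [evalMap_smul hf, hc, smul_smul]
  congr 1
  rw [show d = d - 1 + 1 by omega, pow_succ, ht]
  field_simp

/-- A rational map of degree at least two over an algebraically closed field has a point of exact
period `ℓ` for all but finitely many primes `ℓ`. -/
theorem exists_finset_primes_exact_period [IsAlgClosed L] (hd : 2 ≤ d)
    (hf : ∀ i, (f i).IsHomogeneous d) (hnz : ∀ v : Fin 2 → L, v ≠ 0 → evalMap f v ≠ 0) :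
    ∃ S : Finset ℕ, S.card ≤ d + 3 ∧ ∀ ℓ : ℕ, ℓ.Prime → ℓ ∉ S → ∃ v : Fin 2 → L, v ≠ 0 ∧
      cross v ((evalMap f)^[ℓ] v) = 0 ∧ cross v (evalMap f v) ≠ 0 := by
  classical
  have hne := cross_X_ne_zero hd hf hnz
  have hΦ := isHomogeneous_cross (isHomogeneous_X L) hf
  have hA : ∀ n, ∃ A, cross X ((evalMap f)^[n] X) = A * cross X f := by
    intro n
    have := cross_evalMap_dvd_cross_iterate hf n
    rw [evalMap_X] at this
    exact exists_eq_mul_left_of_dvd this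
  choose A hA using hA
  obtain ⟨R, hR⟩ : ∃ R, cross f (evalMap f f) = R * cross X f := by
    have := cross_evalMap_dvd_cross_evalMap_evalMap hf
    rw [evalMap_X] at this
    exact exists_eq_mul_left_of_dvd this
  have hcross : ∀ v : Fin 2 → L, aeval v (cross X f) = cross v (evalMap f v) := by
    intro v
    have := aeval_cross_iterate_X f 1 v
    rwa [Function.iterate_one, Function.iterate_one, evalMap_X] at this
  have hAsmul : ∀ n, 1 ≤ n → ∀ (t : L) (w : Fin 2 → L),
      aeval (t • w) (A n) = t ^ (1 + d ^ n - (1 + d)) * aeval w (A n) := by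
    intro n hn t w
    refine aeval_smul_of_mul_isHomogeneous ?_ hΦ hne ?_ t w
    · exact Nat.add_le_add_left (Nat.le_self_pow (by omega) d) 1
    · rw [← hA n]
      exact isHomogeneous_cross (isHomogeneous_X L) (isHomogeneous_evalMap_iterate_X hf n)
  obtain ⟨S₀, hS₀, hzeros⟩ := exists_finset_zeros hΦ hne
  have ht : ∀ s : Fin 2 → L, ∃ t : L, s ≠ 0 → cross s (evalMap f s) = 0 →
      t ≠ 0 ∧ evalMap f (t • s) = t • s := by
    intro s
    by_cases h : s ≠ 0 ∧ cross s (evalMap f s) = 0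
    · obtain ⟨t, h1, h2⟩ := exists_smul_fixed hd hf h.1 (hnz s h.1) h.2
      exact ⟨t, fun _ _ => ⟨h1, h2⟩⟩
    · exact ⟨0, fun h1 h2 => absurd ⟨h1, h2⟩ h⟩
  choose t ht using ht
  -- The form `cross X f` has degree `d + 1`, so `S₀` has at most `d + 2` elements; the
  -- characteristic makes `d + 3`.
  refine ⟨insert (ringChar L) (S₀.image fun s => orderOf (aeval (t s • s) R)), ?_, ?_⟩
  · refine (Finset.card_insert_le _ _).trans ?_
    have := Finset.card_image_le (s := S₀) (f := fun s => orderOf (aeval (t s • s) R))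
    omega
  intro ℓ hℓ hS
  have hlt : d < d ^ ℓ := by
    calc d = d ^ 1 := (pow_one d).symm
      _ < d ^ ℓ := Nat.pow_lt_pow_right (by omega) hℓ.one_lt
  have hA0 : aeval (0 : Fin 2 → L) (A ℓ) = 0 := by
    have := hAsmul ℓ hℓ.one_le 0 0
    rwa [zero_smul, zero_pow (by omega), zero_mul] at this
  obtain ⟨w, hw, hAw⟩ := exists_ne_zero_aeval_eq_zero hA0
  refine ⟨w, hw, ?_, fun hfix => hS ?_⟩
  · have := congrArg (aeval w) (hA ℓ)
    rwa [aeval_cross_iterate_X, map_mul, hAw, zero_mul] at this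
  obtain ⟨s, hs, c, hc, rfl⟩ := hzeros w hw (by rw [hcross, hfix])
  have hs0 : s ≠ 0 := by
    rintro rfl
    exact hw (smul_zero c)
  rw [evalMap_smul hf, cross_smul_left, cross_smul_right, mul_eq_zero, mul_eq_zero] at hfix
  obtain ⟨ht0, hts⟩ := ht s hs0 ((hfix.resolve_left hc).resolve_left (pow_ne_zero _ hc))
  rw [hAsmul ℓ hℓ.one_le, mul_eq_zero] at hAw
  have hgeom := aeval_quotient_eq_geom_sum hne hA hR (smul_ne_zero ht0 hs0) hts ℓ
  rw [hAsmul ℓ hℓ.one_le, hAw.resolve_left (pow_ne_zero _ hc), mul_zero] at hgeom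
  rw [Finset.mem_insert, Finset.mem_image]
  -- A vanishing geometric sum of length `ℓ` has ratio `1` with `ℓ = 0` in `L`, or a ratio of exact
  -- order `ℓ`.
  by_cases h1 : aeval (t s • s) R = 1
  · left
    rw [h1] at hgeom
    simp only [one_pow, Finset.sum_const, Finset.card_range, nsmul_eq_mul, mul_one] at hgeom
    have hdvd := (ringChar.spec L ℓ).mp hgeom.symm
    exact ((hℓ.eq_one_or_self_of_dvd _ hdvd).resolve_left CharP.ringChar_ne_one).symm
  · right
    refine ⟨s, hs, ?_⟩
    have : Fact ℓ.Prime := ⟨hℓ⟩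
    refine orderOf_eq_prime ?_ h1
    have := geom_sum_mul (aeval (t s • s) R) ℓ
    rw [← hgeom, zero_mul] at this
    exact (sub_eq_zero.mp this.symm)

end Iterates

universe u

/-! ### Linear action and the twist `g⁻¹ ∘ f`. -/

section LinearAction

variable {K : Type u} [Field K] {B : Type u} [CommRing B] [Algebra K B]

/-- The action of a matrix over `K` on vectors with coordinates in a `K`-algebra. -/
def act (g : GL (Fin 2) K) (v : Fin 2 → B) : Fin 2 → B :=
  fun i => ∑ j, algebraMap K B ((g : Matrix (Fin 2) (Fin 2) K) i j) * v j

theorem act_one (v : Fin 2 → B) : act (1 : GL (Fin 2) K) v = v := by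
  funext i
  fin_cases i <;> simp [act, Fin.sum_univ_two]

theorem act_mul (g g' : GL (Fin 2) K) (v : Fin 2 → B) : act (g * g') v = act g (act g' v) := by
  funext i
  simp only [act, Units.val_mul, Matrix.mul_apply, Fin.sum_univ_two, map_add, map_mul]
  ring

theorem act_smul (g : GL (Fin 2) K) (t : B) (v : Fin 2 → B) : act g (t • v) = t • act g v := by
  funext i
  simp only [act, Fin.sum_univ_two, Pi.smul_apply, smul_eq_mul]
  ring

theorem act_mul_scalar (g : GL (Fin 2) K) (a : Kˣ) (v : Fin 2 → B) :
    act (g * Matrix.GeneralLinearGroup.scalar (Fin 2) a) v = algebraMap K B a • act g v := by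
  have h : act (Matrix.GeneralLinearGroup.scalar (Fin 2) a) v = algebraMap K B a • v := by
    funext i
    fin_cases i <;> simp [act, Fin.sum_univ_two]
  rw [act_mul, h, act_smul]

theorem cross_act_act (g : GL (Fin 2) K) (v w : Fin 2 → B) :
    cross (act g v) (act g w) = algebraMap K B (g : Matrix (Fin 2) (Fin 2) K).det * cross v w := by
  simp only [cross, act, Fin.sum_univ_two, Matrix.det_fin_two, map_sub, map_mul]
  ring

theorem map_act {B' : Type u} [CommRing B'] [Algebra K B'] (σ : B →ₐ[K] B') (g : GL (Fin 2) K)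
    (v : Fin 2 → B) : (fun i => σ (act g v i)) = act g (fun i => σ (v i)) := by
  funext i
  simp [act]

theorem act_ne_zero (g : GL (Fin 2) K) {v : Fin 2 → B} (hv : v ≠ 0) : act g v ≠ 0 := by
  intro h
  have h1 : act g⁻¹ (act g v) = v := by rw [← act_mul, inv_mul_cancel, act_one]
  rw [h] at h1
  refine hv (h1.symm.trans ?_)
  funext i
  simp [act]

theorem det_coe_ne_zero (g : GL (Fin 2) K) : (g : Matrix (Fin 2) (Fin 2) K).det ≠ 0 :=
  (Matrix.isUnits_det_units g).ne_zero

theorem act_X (g : GL (Fin 2) K) : act g X = mobiusForm g := rfl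

/-- The polynomial map `f` commutes with `g` up to a nonzero scalar. -/
def CommutesUpToScalar (f : Fin 2 → MvPolynomial (Fin 2) K) (g : GL (Fin 2) K) : Prop :=
  ∃ c : K, c ≠ 0 ∧ ∀ (B : Type u) [CommRing B] [Algebra K B] (v : Fin 2 → B),
    evalMap f (act g v) = algebraMap K B c • act g (evalMap f v)

variable {f : Fin 2 → MvPolynomial (Fin 2) K}

theorem CommutesUpToScalar.one : CommutesUpToScalar f 1 :=
  ⟨1, one_ne_zero, fun B _ _ v => by rw [act_one, act_one, map_one, one_smul]⟩

theorem CommutesUpToScalar.mul {g g' : GL (Fin 2) K} (h : CommutesUpToScalar f g)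
    (h' : CommutesUpToScalar f g') : CommutesUpToScalar f (g * g') := by
  obtain ⟨c, hc, h⟩ := h
  obtain ⟨c', hc', h'⟩ := h'
  refine ⟨c * c', mul_ne_zero hc hc', fun B _ _ v => ?_⟩
  rw [act_mul, h, h', act_smul, smul_smul, map_mul, act_mul]

theorem CommutesUpToScalar.pow {g : GL (Fin 2) K} (h : CommutesUpToScalar f g) (n : ℕ) :
    CommutesUpToScalar f (g ^ n) := by
  induction n with
  | zero => simpa using CommutesUpToScalar.one
  | succ n ih => rw [pow_succ]; exact ih.mul h

/-- The forms of the composition `g⁻¹ ∘ f`. -/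
def twist (f : Fin 2 → MvPolynomial (Fin 2) K) (g : GL (Fin 2) K) :
    Fin 2 → MvPolynomial (Fin 2) K :=
  act g⁻¹ f

theorem evalMap_twist (f : Fin 2 → MvPolynomial (Fin 2) K) (g : GL (Fin 2) K) (v : Fin 2 → B) :
    evalMap (twist f g) v = act g⁻¹ (evalMap f v) :=
  map_act (aeval v) g⁻¹ f

theorem isHomogeneous_act {d : ℕ} {w : Fin 2 → MvPolynomial (Fin 2) K}
    (hw : ∀ i, (w i).IsHomogeneous d) (g : GL (Fin 2) K) (i : Fin 2) :
    (act g w i).IsHomogeneous d :=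
  IsHomogeneous.sum _ _ _ fun j _ => (hw j).C_mul _

/-- Commutation moves all the factors `g⁻¹` past `f`. The constant is uniform in `B`, so the
identity applies both to the generic vector `X` and to points over the algebraic closure. -/
theorem evalMap_twist_iterate {d : ℕ} (hf : ∀ i, (f i).IsHomogeneous d) {g : GL (Fin 2) K}
    (hg : CommutesUpToScalar f g) (n : ℕ) :
    ∃ c : K, c ≠ 0 ∧ ∀ (B : Type u) [CommRing B] [Algebra K B] (v : Fin 2 → B),
      act (g ^ n) ((evalMap (twist f g))^[n] v) = algebraMap K B c • (evalMap f)^[n] v := by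
  induction n with
  | zero => exact ⟨1, one_ne_zero, fun B _ _ v => by simp [act_one]⟩
  | succ n ih =>
    obtain ⟨c, hc, h⟩ := ih
    obtain ⟨c', hc', h'⟩ := hg.pow n
    refine ⟨c'⁻¹ * c ^ d, mul_ne_zero (inv_ne_zero hc') (pow_ne_zero _ hc), fun B _ _ v => ?_⟩
    have h1 := congrArg (evalMap f) (h B v)
    rw [h', evalMap_smul hf] at h1
    rw [Function.iterate_succ_apply', evalMap_twist, pow_succ, act_mul, ← act_mul g g⁻¹,
      mul_inv_cancel, act_one, Function.iterate_succ_apply', map_mul, mul_smul, map_pow, ← h1,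
      smul_smul, ← map_mul, inv_mul_cancel₀ hc', map_one, one_smul]

theorem cross_act_pow_iterate {d : ℕ} (hf : ∀ i, (f i).IsHomogeneous d) {g : GL (Fin 2) K}
    (hg : CommutesUpToScalar f g) (n : ℕ) :
    ∃ c : K, c ≠ 0 ∧ ∀ (B : Type u) [CommRing B] [Algebra K B] (v : Fin 2 → B),
      cross (act (g ^ n) v) ((evalMap f)^[n] v) =
        algebraMap K B c * cross v ((evalMap (twist f g))^[n] v) := by
  obtain ⟨c, hc, h⟩ := evalMap_twist_iterate hf hg n
  refine ⟨c⁻¹ * ((g ^ n : GL (Fin 2) K) : Matrix (Fin 2) (Fin 2) K).det,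
    mul_ne_zero (inv_ne_zero hc) (det_coe_ne_zero _), fun B _ _ v => ?_⟩
  have h1 : (evalMap f)^[n] v =
      algebraMap K B c⁻¹ • act (g ^ n) ((evalMap (twist f g))^[n] v) := by
    rw [h, smul_smul, ← map_mul, inv_mul_cancel₀ hc, map_one, one_smul]
  rw [h1, cross_smul_right, cross_act_act, map_mul, mul_assoc]

end LinearAction

/-! ### The forms `φ^N - h^j` and polynomiality of `Ψ*`. -/

section Forms

variable {K : Type u} [Field K] {d : ℕ} (φ : RationalMap K d)

theorem RationalMap.iterForm_eq (N : ℕ) : φ.iterForm N = (evalMap φ.form)^[N] X := by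
  induction N with
  | zero => rfl
  | succ N ih =>
    have h := aeval_evalMap_iterate_X φ.form N φ.form
    rw [Function.iterate_succ_apply, evalMap_X, ← h]
    funext i
    rw [RationalMap.iterForm, ih]
    rfl

theorem diffForm_eq (N : ℕ) (g : GL (Fin 2) K) :
    diffForm φ N g = cross (act g X) ((evalMap φ.form)^[N] X) := by
  rw [diffForm, φ.iterForm_eq, act_X, cross]

theorem aeval_diffForm {B : Type u} [CommRing B] [Algebra K B] (N : ℕ) (g : GL (Fin 2) K)
    (v : Fin 2 → B) :
    aeval v (diffForm φ N g) = cross (act g v) ((evalMap φ.form)^[N] v) := by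
  rw [diffForm_eq, map_cross (aeval v), aeval_evalMap_iterate_X, map_act]
  simp

theorem RationalMap.IsAutomorphism.commutes {φ : RationalMap K d} {h : GL (Fin 2) K}
    (haut : φ.IsAutomorphism h) : CommutesUpToScalar φ.form h := by
  obtain ⟨c, hc, hconj⟩ := haut
  refine ⟨c, hc, fun B _ _ v => ?_⟩
  have h1 : act h⁻¹ (evalMap φ.form (act h v)) = algebraMap K B c • evalMap φ.form v := by
    funext i
    have h2 := congrArg (aeval v) (hconj i)
    rw [map_mul, aeval_C] at h2
    refine Eq.trans ?_ h2
    have h3 : ∀ j, aeval v (bind₁ (mobiusForm h) (φ.form j)) = aeval (act h v) (φ.form j) := by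
      intro j
      rw [aeval_bind₁]
      congr 2
      rw [← act_X, map_act (aeval v)]
      simp
    simp only [RationalMap.conjForm, map_sum, map_mul, aeval_C, h3]
    rfl
  rw [← act_smul, ← h1, ← act_mul, mul_inv_cancel, act_one]

theorem diffForm_mul_scalar (N : ℕ) (g : GL (Fin 2) K) (a : Kˣ) :
    diffForm φ N (g * Matrix.GeneralLinearGroup.scalar (Fin 2) a) =
      C (a : K) * diffForm φ N g := by
  rw [diffForm_eq, diffForm_eq, act_mul_scalar, cross_smul_left]
  rfl

theorem diffForm_dvd_of_mk_eq (N : ℕ) {g g' : GL (Fin 2) K}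
    (h : (Matrix.ProjGenLinGroup.mk g : PGL(2, K)) = Matrix.ProjGenLinGroup.mk g') :
    diffForm φ N g ∣ diffForm φ N g' := by
  obtain ⟨a, rfl⟩ := Matrix.ProjGenLinGroup.mk_eq_mk_iff.mp h
  rw [diffForm_mul_scalar]
  exact dvd_mul_left _ _

/-- Up to nonzero constants, both sides are the first and the `n`-th period form of the twist by
`g`. -/
theorem diffForm_one_dvd {g : GL (Fin 2) K} (hg : CommutesUpToScalar φ.form g) (n : ℕ) :
    diffForm φ 1 g ∣ diffForm φ n (g ^ n) := by
  have htw := isHomogeneous_act φ.isHomogeneous g⁻¹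
  obtain ⟨c, hc, h⟩ := cross_act_pow_iterate φ.isHomogeneous hg 1
  obtain ⟨c', hc', h'⟩ := cross_act_pow_iterate φ.isHomogeneous hg n
  rw [diffForm_eq, diffForm_eq, h']
  rw [← pow_one g, h, pow_one]
  refine Dvd.dvd.mul_left ?_ _
  have hunit : IsUnit (algebraMap K (MvPolynomial (Fin 2) K) c) := (IsUnit.mk0 c hc).map _
  rw [hunit.mul_left_dvd]
  exact cross_evalMap_dvd_cross_iterate htw n

theorem evalMap_form_ne_zero {v : Fin 2 → AlgebraicClosure K} (hv : v ≠ 0) :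
    evalMap φ.form v ≠ 0 := by
  obtain ⟨i, hi⟩ := φ.no_common_zero v hv
  exact fun h => hi (congrFun h i)

theorem evalMap_form_iterate_ne_zero {v : Fin 2 → AlgebraicClosure K} (hv : v ≠ 0) (N : ℕ) :
    (evalMap φ.form)^[N] v ≠ 0 := by
  induction N with
  | zero => exact hv
  | succ N ih =>
    rw [Function.iterate_succ_apply']
    exact evalMap_form_ne_zero φ ih

theorem evalMap_map_algebraMap (f : Fin 2 → MvPolynomial (Fin 2) K)
    (v : Fin 2 → AlgebraicClosure K) :
    evalMap (fun i => map (algebraMap K (AlgebraicClosure K)) (f i)) v = evalMap f v := by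
  funext i
  exact aeval_map_algebraMap _ _ _

/-- The map `g⁻¹ ∘ φ^N` has degree `d ^ N ≥ 2` and no common zero, so it is not the identity. -/
theorem diffForm_ne_zero (hd : 2 ≤ d) {N : ℕ} (hN : N ≠ 0) (g : GL (Fin 2) K) :
    diffForm φ N g ≠ 0 := by
  intro h0
  let w : Fin 2 → MvPolynomial (Fin 2) K := act g⁻¹ ((evalMap φ.form)^[N] X)
  have hw : ∀ i, (w i).IsHomogeneous (d ^ N) :=
    isHomogeneous_act (isHomogeneous_evalMap_iterate_X φ.isHomogeneous N) g⁻¹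
  have hev : ∀ v : Fin 2 → AlgebraicClosure K,
      evalMap w v = act g⁻¹ ((evalMap φ.form)^[N] v) := by
    intro v
    rw [← aeval_evalMap_iterate_X φ.form N v, ← map_act (aeval v)]
    rfl
  refine cross_X_ne_zero (L := AlgebraicClosure K) (d := d ^ N)
    (f := fun i => map (algebraMap K (AlgebraicClosure K)) (w i))
    (hd.trans (Nat.le_self_pow hN d)) (fun i => (hw i).map _)
    (fun v hv => ?_) ?_
  · rw [evalMap_map_algebraMap, hev]
    exact act_ne_zero _ (evalMap_form_iterate_ne_zero φ hv N)
  · have h1 : cross X w = 0 := by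
      have h2 := cross_act_act g X w
      rw [← act_mul, mul_inv_cancel, act_one, ← diffForm_eq, h0, eq_comm, mul_eq_zero] at h2
      exact h2.resolve_left ((map_ne_zero_iff _ (C_injective _ _)).mpr (det_coe_ne_zero g))
    have h3 := congrArg (map (algebraMap K (AlgebraicClosure K))) h1
    simpa [cross] using h3

theorem Psi_ne_zero (hd : 2 ≤ d) {N : ℕ} (hN : N ≠ 0) (h : GL (Fin 2) K) (p : ℕ) :
    Psi φ h p N ≠ 0 :=
  Finset.prod_ne_zero_iff.mpr fun _ _ => diffForm_ne_zero φ hd hN _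

theorem Psi_one_dvd_Psi {h : GL (Fin 2) K} {p ℓ : ℕ} (hp : p.Prime) (hℓ : ℓ.Prime) (hne : ℓ ≠ p)
    (hord : orderOf (Matrix.ProjGenLinGroup.mk h : PGL(2, K)) = p)
    (hh : CommutesUpToScalar φ.form h) : Psi φ h p 1 ∣ Psi φ h p ℓ := by
  have hcop : Nat.gcd p ℓ = 1 := (Nat.coprime_primes hp hℓ).mpr hne.symm
  have hmaps : ∀ j ∈ Finset.Icc 1 (p - 1), j * ℓ % p ∈ Finset.Icc 1 (p - 1) := by
    intro j hj
    rw [Finset.mem_Icc] at hj ⊢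
    have h1 : j * ℓ % p < p := Nat.mod_lt _ hp.pos
    have h2 : j * ℓ % p ≠ 0 := by
      intro h0
      have h3 := (Nat.Coprime.dvd_of_dvd_mul_right hcop (Nat.dvd_of_mod_eq_zero h0))
      have := Nat.le_of_dvd (by omega) h3
      omega
    omega
  have hinj : Set.InjOn (fun j => j * ℓ % p) (Finset.Icc 1 (p - 1)) := by
    intro i hi j hj hij
    rw [Finset.mem_coe, Finset.mem_Icc] at hi hj
    have h1 : i ≡ j [MOD p] := Nat.ModEq.cancel_right_of_coprime hcop hij
    exact Nat.ModEq.eq_of_lt_of_lt h1 (by omega) (by omega)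
  have himg : (Finset.Icc 1 (p - 1)).image (fun j => j * ℓ % p) = Finset.Icc 1 (p - 1) :=
    Finset.eq_of_subset_of_card_le (Finset.image_subset_iff.mpr hmaps)
      (Finset.card_image_of_injOn hinj).ge
  have hprod : Psi φ h p ℓ = ∏ j ∈ Finset.Icc 1 (p - 1), diffForm φ ℓ (h ^ (j * ℓ % p)) := by
    rw [Psi]
    conv_lhs => rw [← himg]
    exact Finset.prod_image hinj
  rw [hprod, Psi]
  refine Finset.prod_dvd_prod_of_dvd _ _ fun j _ => ?_
  -- Exponents of `h` may be reduced mod `p` only in `PGL`; the matrices then differ by a scalar,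
  -- harmless for divisibility.
  refine (diffForm_one_dvd φ (hh.pow j) ℓ).trans (diffForm_dvd_of_mk_eq φ ℓ ?_)
  rw [← pow_mul, map_pow, map_pow, ← hord, pow_mod_orderOf]

theorem exists_mul_Psi_eq {h : GL (Fin 2) K} {p ℓ : ℕ} (hd : 2 ≤ d) (hp : p.Prime) (hℓ : ℓ.Prime)
    (hord : orderOf (Matrix.ProjGenLinGroup.mk h : PGL(2, K)) = p)
    (hh : CommutesUpToScalar φ.form h) :
    ∃ A : MvPolynomial (Fin 2) K,
      algebraMap (MvPolynomial (Fin 2) K) (FractionRing (MvPolynomial (Fin 2) K)) A =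
        PsiStar φ h p ℓ ∧
      A ≠ 0 ∧ (ℓ ≠ p → A * Psi φ h p 1 = Psi φ h p ℓ) := by
  have hℓ0 := Psi_ne_zero φ hd hℓ.ne_zero h p
  by_cases hne : ℓ = p
  · subst hne
    refine ⟨Psi φ h ℓ ℓ, ?_, hℓ0, fun h0 => absurd rfl h0⟩
    -- For `ℓ = p` the condition `pk ∤ N` drops `k = 1`, so `Ψ*` has no denominator.
    have hfilter : {k ∈ ℓ.divisors | ¬ ℓ * k ∣ ℓ} = {ℓ} := by
      ext k
      rw [Finset.mem_filter, hℓ.divisors, Finset.mem_insert, Finset.mem_singleton]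
      constructor
      · rintro ⟨rfl | rfl, h2⟩
        · simp at h2
        · rfl
      · rintro rfl
        refine ⟨Or.inr rfl, fun h1 => ?_⟩
        have := Nat.le_of_dvd hℓ.pos h1
        nlinarith [hℓ.two_le]
    rw [PsiStar, hfilter, Finset.prod_singleton, Nat.div_self hℓ.pos]
    simp
  · obtain ⟨A, hA⟩ := exists_eq_mul_left_of_dvd (Psi_one_dvd_Psi φ hp hℓ hne hord hh)
    refine ⟨A, ?_, ?_, fun _ => hA.symm⟩
    · have hfilter : {k ∈ ℓ.divisors | ¬ p * k ∣ ℓ} = {1, ℓ} := by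
        rw [← hℓ.divisors]
        refine Finset.filter_true_of_mem fun k _ hk => ?_
        have : p ∣ ℓ := (dvd_mul_right p k).trans hk
        exact hne ((Nat.prime_dvd_prime_iff_eq hp hℓ).mp this).symm
      have h1 : algebraMap (MvPolynomial (Fin 2) K) (FractionRing (MvPolynomial (Fin 2) K))
          (Psi φ h p 1) ≠ 0 :=
        (map_ne_zero_iff _ (IsFractionRing.injective _ _)).mpr (Psi_ne_zero φ hd one_ne_zero h p)
      rw [PsiStar, hfilter, Finset.prod_pair hℓ.one_lt.ne, Nat.div_one, Nat.div_self hℓ.pos, hA,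
        ArithmeticFunction.moebius_apply_prime hℓ, ArithmeticFunction.moebius_apply_one, map_mul]
      field_simp
    · rintro rfl
      exact hℓ0 (by rw [hA, zero_mul])

end Forms

/-! ### Points of the projective line and fixed points of `PGL`. -/

section Points

variable {L : Type u} [Field L]

theorem mk_eq_mk_iff_cross {v w : Fin 2 → L} (hv : v ≠ 0) (hw : w ≠ 0) :
    Projectivization.mk L v hv = Projectivization.mk L w hw ↔ cross v w = 0 := by
  rw [eq_comm, Projectivization.mk_eq_mk_iff']
  constructor
  · rintro ⟨a, rfl⟩
    rw [cross_smul_right, cross_self, mul_zero]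
  · intro h
    obtain ⟨c, hc⟩ := exists_smul_of_cross_eq_zero hv h
    exact ⟨c, hc.symm⟩

theorem mk_smul_mk_eq_iff (g : GL (Fin 2) L) {v w : Fin 2 → L} (hv : v ≠ 0) (hw : w ≠ 0) :
    (Matrix.ProjGenLinGroup.mk g : PGL(2, L)) • Projectivization.mk L v hv =
      Projectivization.mk L w hw ↔ cross (act g v) w = 0 := by
  rw [Projectivization.PGL.mk_smul_mk, mk_eq_mk_iff_cross]
  have : g • v = act g v := by
    funext i
    simp [act, Units.smul_def, Matrix.mulVec, dotProduct, Fin.sum_univ_two]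
  rw [this]

variable {K : Type u} [Field K]

theorem toPGL_smul_mk (g : GL (Fin 2) K) {v : Fin 2 → AlgebraicClosure K} (hv : v ≠ 0) :
    toPGL g • Projectivization.mk (AlgebraicClosure K) v hv =
      Projectivization.mk (AlgebraicClosure K) (act g v) (act_ne_zero g hv) := by
  rw [toPGL, mk_smul_mk_eq_iff]
  have : act (g.map (algebraMap K (AlgebraicClosure K))) v = act g v := by
    funext i
    simp [act]
  rw [this, cross_self]

theorem toPGL_pow (g : GL (Fin 2) K) (n : ℕ) : toPGL (g ^ n) = toPGL g ^ n := by
  simp [toPGL]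

theorem toPGL_eq_map (g : GL (Fin 2) K) : toPGL g =
    Matrix.ProjGenLinGroup.map (algebraMap K (AlgebraicClosure K))
      (Matrix.ProjGenLinGroup.mk g) := rfl

/-- A matrix with three distinct fixed points on the projective line acts trivially. -/
theorem mk_eq_one_of_three_fixed (g : GL (Fin 2) K) {u v w : Fin 2 → AlgebraicClosure K}
    (hu : cross (act g u) u = 0) (hv : cross (act g v) v = 0) (hw : cross (act g w) w = 0)
    (huv : cross u v ≠ 0) (huw : cross u w ≠ 0) (hvw : cross v w ≠ 0) :
    (Matrix.ProjGenLinGroup.mk g : PGL(2, K)) = 1 := by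
  set σ := algebraMap K (AlgebraicClosure K) with hσ
  set a := g.1 0 0 with ha
  set b := g.1 0 1 with hb
  set c := g.1 1 0 with hc
  set e := g.1 1 1 with he
  -- Fixed points are zeros of a binary quadratic form. At three of them, elimination gives an outer
  -- coefficient times the homogeneous Vandermonde determinant `hprod`.
  have hq : ∀ x : Fin 2 → AlgebraicClosure K, cross (act g x) x =
      σ c * x 0 ^ 2 + (σ e - σ a) * (x 0 * x 1) - σ b * x 1 ^ 2 := by
    intro x
    simp only [cross, act, Fin.sum_univ_two]
    ring
  rw [hq] at hu hv hw
  have hprod : cross u v * cross u w * cross v w ≠ 0 := mul_ne_zero (mul_ne_zero huv huw) hvw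
  simp only [cross] at hprod
  have h1 : σ c = 0 := by
    refine (mul_eq_zero.mp ?_).resolve_right hprod
    linear_combination ((v 1 * w 1) * (v 1 * w 0 - v 0 * w 1)) * hu -
      ((u 1 * w 1) * (u 1 * w 0 - u 0 * w 1)) * hv + ((u 1 * v 1) * (u 1 * v 0 - u 0 * v 1)) * hw
  have h2 : σ b = 0 := by
    refine (mul_eq_zero.mp ?_).resolve_right hprod
    linear_combination (-(v 0 * w 0) * (v 1 * w 0 - v 0 * w 1)) * hu +
      ((u 0 * w 0) * (u 1 * w 0 - u 0 * w 1)) * hv - ((u 0 * v 0) * (u 1 * v 0 - u 0 * v 1)) * hw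
  have h3 : σ e - σ a = 0 := by
    rw [h1, h2] at hu hv
    by_contra hne
    have hu' : u 0 * u 1 = 0 := (mul_eq_zero.mp (by linear_combination hu)).resolve_left hne
    have hv' : v 0 * v 1 = 0 := (mul_eq_zero.mp (by linear_combination hv)).resolve_left hne
    rw [h1, h2] at hw
    have hw' : w 0 * w 1 = 0 := (mul_eq_zero.mp (by linear_combination hw)).resolve_left hne
    simp only [cross] at huv huw hvw
    rcases mul_eq_zero.mp hu' with h | h <;> rcases mul_eq_zero.mp hv' with h' | h' <;>
      rcases mul_eq_zero.mp hw' with h'' | h'' <;> simp_all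
  have inj := (algebraMap K (AlgebraicClosure K)).injective
  have hb0 : b = 0 := inj (by rw [← hσ, h2, map_zero])
  have hc0 : c = 0 := inj (by rw [← hσ, h1, map_zero])
  have hea : e = a := inj (sub_eq_zero.mp h3)
  have ha0 : a ≠ 0 := by
    intro h0
    refine det_coe_ne_zero g ?_
    rw [Matrix.det_fin_two]
    change a * e - b * c = 0
    rw [h0, hb0]
    ring
  rw [eq_comm, ← Matrix.ProjGenLinGroup.mk_one, Matrix.ProjGenLinGroup.mk_eq_mk_iff]
  refine ⟨Units.mk0 a ha0, ?_⟩
  ext i j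
  fin_cases i <;> fin_cases j <;> simp [← ha, ← hb, ← hc, ← he, hb0, hc0, hea]

end Points

/-! ### Removing the fixed points of `h` from `Ψ*`. -/

section TunedQuotient

variable {K : Type u} [Field K]

theorem ordAlong_algebraMap {l A : MvPolynomial (Fin 2) K} (hl : ¬ IsUnit l) :
    ordAlong l (algebraMap (MvPolynomial (Fin 2) K) (FractionRing (MvPolynomial (Fin 2) K)) A) =
      multiplicity l A := by
  obtain ⟨h1, h2⟩ := IsFractionRing.num_den_unique (MvPolynomial (Fin 2) K)
    (algebraMap (MvPolynomial (Fin 2) K) (FractionRing (MvPolynomial (Fin 2) K)) A) A 1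
    isRelPrime_one_right (IsLocalization.mk'_one _ _)
  have h3 : multiplicity l
      (IsFractionRing.num (MvPolynomial (Fin 2) K)
        (algebraMap (MvPolynomial (Fin 2) K) (FractionRing (MvPolynomial (Fin 2) K)) A)) =
      multiplicity l A := multiplicity_eq_of_associated_right h1
  have h4 : multiplicity l
      (IsFractionRing.den (MvPolynomial (Fin 2) K)
        (algebraMap (MvPolynomial (Fin 2) K) (FractionRing (MvPolynomial (Fin 2) K)) A) :
          MvPolynomial (Fin 2) K) = 0 := by
    rw [multiplicity_eq_of_associated_right h2]
    exact multiplicity_eq_zero.mpr fun h => hl (isUnit_of_dvd_one h)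
  rw [ordAlong, h3, h4]
  simp

theorem cross_rep_ne_zero {P Q : P1 K} (h : P ≠ Q) : cross P.rep Q.rep ≠ 0 := by
  intro h0
  refine h ?_
  rw [← P.mk_rep, ← Q.mk_rep, mk_eq_mk_iff_cross]
  exact h0

/-- Both variables, multiplied by the nonzero resultant `cross P.rep Q.rep`, are combinations of the
two linear forms. -/
theorem isRelPrime_pointForm {P Q : P1 K} (h : P ≠ Q) :
    IsRelPrime (pointForm P) (pointForm Q) := by
  intro g hP hQ
  have hc : IsUnit (C (cross P.rep Q.rep) : MvPolynomial (Fin 2) K) :=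
    (IsUnit.mk0 _ (cross_rep_ne_zero h)).map C
  rw [isUnit_iff_dvd_one]
  refine dvd_of_forall_dvd_X_pow_mul fun i => ⟨1, ?_⟩
  have h1 : g ∣ C (cross P.rep Q.rep) * X i := by
    have h2 := (hP.mul_left (C (Q.rep i))).sub (hQ.mul_left (C (P.rep i)))
    refine h2.trans (dvd_of_eq ?_)
    simp only [pointForm, cross, map_sub, map_mul]
    fin_cases i
    · simp only [Fin.zero_eta]; ring
    · simp only [Fin.mk_one]; ring
  rw [pow_one, mul_one]
  exact (hc.dvd_mul_left).mp h1

theorem not_isUnit_pointForm (P : P1 K) : ¬ IsUnit (pointForm P) := by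
  intro h
  have := h.map (aeval (0 : Fin 2 → K))
  simp [pointForm] at this

theorem fixed_of_aeval_pointForm_eq_zero {h : GL (Fin 2) K} {P : P1 K}
    (hP : (Matrix.ProjGenLinGroup.mk h : PGL(2, K)) • P = P) {v : Fin 2 → AlgebraicClosure K}
    (hv : v ≠ 0) (h0 : aeval v (pointForm P) = 0) :
    toPGL h • Projectivization.mk (AlgebraicClosure K) v hv = Projectivization.mk _ v hv := by
  rw [toPGL_smul_mk, mk_eq_mk_iff_cross]
  have hr : cross (act h P.rep) P.rep = 0 := by
    rw [← mk_smul_mk_eq_iff h P.rep_nonzero P.rep_nonzero, P.mk_rep, hP]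
  let σ := Algebra.ofId K (AlgebraicClosure K)
  have hrσ := congrArg σ hr
  rw [map_cross, map_act, map_zero] at hrσ
  have hrep : (fun i => σ (P.rep i)) ≠ 0 := by
    intro h1
    refine P.rep_nonzero (funext fun i => ?_)
    exact (map_eq_zero σ).mp (congrFun h1 i)
  have hcr : cross (fun i => σ (P.rep i)) v = 0 := by
    rw [← h0]
    simp [cross, pointForm, σ, Algebra.ofId_apply]
  obtain ⟨c, rfl⟩ := exists_smul_of_cross_eq_zero hrep hcr
  rw [act_smul, cross_smul_left, cross_smul_right, hrσ, mul_zero, mul_zero]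

theorem exists_mul_eq_and_eq_PsiTilde {d : ℕ} (φ : RationalMap K d) {h : GL (Fin 2) K} {p N : ℕ}
    {A : MvPolynomial (Fin 2) K}
    (hA : algebraMap (MvPolynomial (Fin 2) K) (FractionRing (MvPolynomial (Fin 2) K)) A =
      PsiStar φ h p N) :
    ∃ Ψ D : MvPolynomial (Fin 2) K, Ψ * D = A ∧
      algebraMap (MvPolynomial (Fin 2) K) (FractionRing (MvPolynomial (Fin 2) K)) Ψ =
        PsiTilde φ h p N ∧
      ∀ (v : Fin 2 → AlgebraicClosure K) (hv : v ≠ 0), aeval v D = 0 →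
        toPGL h • Projectivization.mk (AlgebraicClosure K) v hv = Projectivization.mk _ v hv := by
  classical
  set S := {P : P1 K | (Matrix.ProjGenLinGroup.mk h : PGL(2, K)) • P = P} with hS
  set F : P1 K → FractionRing (MvPolynomial (Fin 2) K) := fun P =>
    algebraMap (MvPolynomial (Fin 2) K) (FractionRing (MvPolynomial (Fin 2) K)) (pointForm P) ^
      ordAlong (pointForm P) (PsiStar φ h p N) with hF
  have hFpow : ∀ P, F P = algebraMap (MvPolynomial (Fin 2) K)
      (FractionRing (MvPolynomial (Fin 2) K)) (pointForm P ^ multiplicity (pointForm P) A) := by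
    intro P
    rw [hF, ← hA]
    simp only [ordAlong_algebraMap (not_isUnit_pointForm P), zpow_natCast, map_pow]
  have htilde : PsiTilde φ h p N = PsiStar φ h p N / ∏ᶠ P ∈ S, F P := rfl
  obtain ⟨T, hTS, hT⟩ : ∃ T : Finset (P1 K), (∀ P ∈ T, P ∈ S) ∧
      ∏ᶠ P ∈ S, F P = ∏ P ∈ T, F P := by
    -- Over an infinite support `finprod` is `1` by convention, and the empty set serves.
    by_cases hfin : (S ∩ Function.mulSupport F).Finite
    · refine ⟨hfin.toFinset, fun P hP => ((hfin.mem_toFinset).mp hP).1, ?_⟩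
      exact finprod_mem_eq_prod F hfin
    · exact ⟨∅, by simp, by rw [finprod_mem_eq_one_of_infinite hfin, Finset.prod_empty]⟩
  have hdvd : ∏ P ∈ T, pointForm P ^ multiplicity (pointForm P) A ∣ A := by
    refine Finset.prod_dvd_of_isRelPrime (fun P _ Q _ hPQ => ?_) fun P _ => pow_multiplicity_dvd _ _
    exact (isRelPrime_pointForm hPQ).pow
  have hD0 : algebraMap (MvPolynomial (Fin 2) K) (FractionRing (MvPolynomial (Fin 2) K))
      (∏ P ∈ T, pointForm P ^ multiplicity (pointForm P) A) ≠ 0 := by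
    rw [map_ne_zero_iff _ (IsFractionRing.injective _ _)]
    refine Finset.prod_ne_zero_iff.mpr fun P _ => pow_ne_zero _ fun h0 => ?_
    refine P.rep_nonzero (funext fun i => ?_)
    have h1 := congrArg (aeval ![(1 : K), 0]) h0
    have h2 := congrArg (aeval ![(0 : K), 1]) h0
    simp [pointForm] at h1 h2
    fin_cases i
    · exact h2
    · exact h1
  obtain ⟨Ψ, hΨ⟩ := exists_eq_mul_left_of_dvd hdvd
  refine ⟨Ψ, _, hΨ.symm, ?_, ?_⟩
  · rw [htilde, hT, Finset.prod_congr rfl fun P _ => hFpow P, ← map_prod, ← hA, eq_div_iff hD0,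
      ← map_mul, ← hΨ]
  · intro v hv h0
    rw [map_prod, Finset.prod_eq_zero_iff] at h0
    obtain ⟨P, hP, h1⟩ := h0
    rw [map_pow] at h1
    exact fixed_of_aeval_pointForm_eq_zero (hTS P hP) hv (eq_zero_of_pow_eq_zero h1)

end TunedQuotient

/-! ### From periods of the twist to relations `φ^ℓ(Q) = h^ℓ(Q)`. -/

section Dynamics

variable {K : Type u} [Field K] {d : ℕ} (φ : RationalMap K d)

theorem toPGL_smul_eq_iff (g : GL (Fin 2) K) (P : P1 (AlgebraicClosure K)) :
    toPGL g • P = P ↔ cross (act g P.rep) P.rep = 0 := by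
  rw [← mk_eq_mk_iff_cross (act_ne_zero g P.rep_nonzero) P.rep_nonzero, ← toPGL_smul_mk g P.rep_nonzero,
    P.mk_rep]

theorem mk_eq_one_of_three_fixed_points (g : GL (Fin 2) K) {P Q R : P1 (AlgebraicClosure K)}
    (hP : toPGL g • P = P) (hQ : toPGL g • Q = Q) (hR : toPGL g • R = R)
    (hPQ : P ≠ Q) (hPR : P ≠ R) (hQR : Q ≠ R) :
    (Matrix.ProjGenLinGroup.mk g : PGL(2, K)) = 1 :=
  mk_eq_one_of_three_fixed g ((toPGL_smul_eq_iff g P).mp hP) ((toPGL_smul_eq_iff g Q).mp hQ)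
    ((toPGL_smul_eq_iff g R).mp hR) (cross_rep_ne_zero hPQ) (cross_rep_ne_zero hPR)
    (cross_rep_ne_zero hQR)

theorem toFun_iterate_mk (N : ℕ) {v : Fin 2 → AlgebraicClosure K} (hv : v ≠ 0) :
    φ.toFun^[N] (Projectivization.mk (AlgebraicClosure K) v hv) =
      Projectivization.mk (AlgebraicClosure K) ((evalMap φ.form)^[N] v)
        (evalMap_form_iterate_ne_zero φ hv N) := by
  induction N with
  | zero => rfl
  | succ N ih =>
    rw [Function.iterate_succ_apply', ih]
    simp only [Function.iterate_succ_apply']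
    rfl

theorem toFun_iterate_eq_smul_iff (N : ℕ) (g : GL (Fin 2) K) {v : Fin 2 → AlgebraicClosure K}
    (hv : v ≠ 0) :
    φ.toFun^[N] (Projectivization.mk (AlgebraicClosure K) v hv) =
      toPGL g • Projectivization.mk (AlgebraicClosure K) v hv ↔ aeval v (diffForm φ N g) = 0 := by
  rw [toFun_iterate_mk, toPGL_smul_mk, eq_comm, mk_eq_mk_iff_cross, aeval_diffForm]

theorem toFun_smul {h : GL (Fin 2) K} (hh : CommutesUpToScalar φ.form h)
    (Q : P1 (AlgebraicClosure K)) : φ.toFun (toPGL h • Q) = toPGL h • φ.toFun Q := by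
  obtain ⟨c, -, hc⟩ := hh
  rw [← Q.mk_rep, toPGL_smul_mk]
  have h1 := toFun_iterate_mk φ 1 Q.rep_nonzero
  have h2 := toFun_iterate_mk φ 1 (act_ne_zero h Q.rep_nonzero)
  simp only [Function.iterate_one] at h1 h2
  rw [h1, h2, toPGL_smul_mk, mk_eq_mk_iff_cross, hc, cross_smul_left, cross_self, mul_zero]

theorem exists_primes_iterate_eq_pow_smul (hd : 2 ≤ d) {h : GL (Fin 2) K}
    (hh : CommutesUpToScalar φ.form h) :
    ∃ S : Finset ℕ, S.card ≤ d + 3 ∧ ∀ ℓ : ℕ, ℓ.Prime → ℓ ∉ S →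
      ∃ (v : Fin 2 → AlgebraicClosure K) (hv : v ≠ 0),
        φ.toFun^[ℓ] (Projectivization.mk (AlgebraicClosure K) v hv) =
          toPGL h ^ ℓ • Projectivization.mk (AlgebraicClosure K) v hv ∧
        φ.toFun (Projectivization.mk (AlgebraicClosure K) v hv) ≠
          toPGL h • Projectivization.mk (AlgebraicClosure K) v hv := by
  have hhom := isHomogeneous_act φ.isHomogeneous h⁻¹
  obtain ⟨S, hS, H⟩ := exists_finset_primes_exact_period (L := AlgebraicClosure K)
    (f := fun i => map (algebraMap K (AlgebraicClosure K)) (twist φ.form h i)) hd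
    (fun i => (hhom i).map _)
    (fun v hv => by
      rw [evalMap_map_algebraMap, evalMap_twist]
      exact act_ne_zero _ (evalMap_form_ne_zero φ hv))
  refine ⟨S, hS, fun ℓ hℓ hℓS => ?_⟩
  obtain ⟨v, hv, h1, h2⟩ := H ℓ hℓ hℓS
  have hmap : (evalMap fun i => map (algebraMap K (AlgebraicClosure K)) (twist φ.form h i) :
      (Fin 2 → AlgebraicClosure K) → _) = evalMap (twist φ.form h) := by
    funext v
    exact evalMap_map_algebraMap _ v
  rw [hmap] at h1 h2
  refine ⟨v, hv, ?_, fun heq => h2 ?_⟩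
  · obtain ⟨c, -, hc⟩ := cross_act_pow_iterate φ.isHomogeneous hh ℓ
    rw [← toPGL_pow, toFun_iterate_eq_smul_iff, aeval_diffForm, hc, h1, mul_zero]
  · obtain ⟨c, hc0, hc⟩ := cross_act_pow_iterate φ.isHomogeneous hh 1
    have h3 := (toFun_iterate_eq_smul_iff φ 1 h hv).mp (by rw [Function.iterate_one]; exact heq)
    have h4 := hc _ v
    rw [pow_one, ← aeval_diffForm, h3, eq_comm, mul_eq_zero] at h4
    exact h4.resolve_left ((map_ne_zero _).mpr hc0)

end Dynamics

/-- For a map `f` commuting with a group element `g` of order dividing a prime `p`, a point with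
`f^ℓ x = g^ℓ x` and `f x ≠ g x` has no smaller period relative to the powers of `g`. -/
theorem iterate_ne_pow_smul {G α : Type*} [Group G] [MulAction G α] {f : α → α} {g : G}
    (hfg : ∀ x, f (g • x) = g • f x) {p ℓ : ℕ} (hp : p.Prime) (hℓ : ℓ.Prime) (hne : ℓ ≠ p)
    (hg : g ^ p = 1) {x : α} (h1 : f^[ℓ] x = g ^ ℓ • x) (h2 : f x ≠ g • x) {n : ℕ} (hn : 0 < n)
    (hnℓ : n < ℓ) (j : ℕ) : f^[n] x ≠ g ^ j • x := by
  intro hj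
  have hcomm : Function.Commute (fun x => g⁻¹ • x) f := by
    intro x
    change g⁻¹ • f x = f (g⁻¹ • x)
    rw [inv_smul_eq_iff, ← hfg, smul_inv_smul]
  -- Only the matching exponent `m` gives a period of `g⁻¹ ∘ f`; an arbitrary `j` is first made to
  -- match by iterating `p` times, since `g ^ p = 1`.
  have hper : ∀ m, f^[m] x = g ^ m • x → Function.IsPeriodicPt ((fun x => g⁻¹ • x) ∘ f) m x := by
    intro m hm
    change ((fun x => g⁻¹ • x) ∘ f)^[m] x = x
    rw [hcomm.comp_iterate, Function.comp_apply, hm, smul_iterate_apply, inv_pow, inv_smul_smul]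
  have hfn : ∀ m y, f^[m] (g • y) = g • f^[m] y := by
    intro m
    induction m with
    | zero => exact fun y => rfl
    | succ m ih => intro y; rw [Function.iterate_succ_apply, hfg, ih, Function.iterate_succ_apply]
  have hfnj : ∀ m i y, f^[m] (g ^ i • y) = g ^ i • f^[m] y := by
    intro m i
    induction i with
    | zero => simp
    | succ i ih => intro y; rw [pow_succ, mul_smul, ih, hfn, mul_smul]
  have hpow : ∀ k, f^[n * k] x = g ^ (j * k) • x := by
    intro k
    induction k with
    | zero => simp
    | succ k ih =>
      rw [Nat.mul_succ, Function.iterate_add_apply, hj, hfnj, ih, smul_smul, ← pow_add]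
      congr 2
      ring
  have hnp : f^[n * p] x = g ^ (n * p) • x := by
    rw [hpow, mul_comm j, mul_comm n, pow_mul, pow_mul, hg, one_pow, one_pow]
  have hgcd := (hper _ hnp).gcd (hper _ h1)
  have hcop : Nat.gcd (n * p) ℓ = 1 := by
    refine Nat.Coprime.mul_left ?_ ((Nat.coprime_primes hp hℓ).mpr hne.symm)
    exact (hℓ.coprime_iff_not_dvd.mpr (Nat.not_dvd_of_pos_of_lt hn hnℓ)).symm
  rw [hcop] at hgcd
  have : g⁻¹ • f x = x := hgcd
  exact h2 (by rwa [inv_smul_eq_iff] at this)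

end HTuned

end

/-! ### The main theorem. -/

theorem mainTheorem8 {K : Type*} [Field K] {d : ℕ} (hd : 2 ≤ d)
    (φ : HTuned.RationalMap K d) (p : ℕ) (hp : p.Prime) (h : GL (Fin 2) K)
    (hord : orderOf (Matrix.ProjGenLinGroup.mk h : PGL(2, K)) = p)
    (haut : φ.IsAutomorphism h) (hfix : HTuned.FixedPointsRational h) :
    (∀ ℓ : ℕ, ℓ.Prime → ∃ Ψ : MvPolynomial (Fin 2) K,
      algebraMap (MvPolynomial (Fin 2) K) (FractionRing (MvPolynomial (Fin 2) K)) Ψ =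
        HTuned.PsiTilde φ h p ℓ) ∧
    {ℓ : ℕ | ℓ.Prime ∧ ∃ c : K,
      HTuned.PsiTilde φ h p ℓ =
        algebraMap (MvPolynomial (Fin 2) K) (FractionRing (MvPolynomial (Fin 2) K))
          (MvPolynomial.C c)}.encard ≤ d + 6 ∧
    {ℓ : ℕ | ℓ.Prime ∧ ¬ ∃ Q : HTuned.P1 (AlgebraicClosure K),
      HTuned.HasPrimitiveHPeriod φ h p Q ℓ}.encard ≤ d + 6 := by
  have hh := haut.commutes
  have hH : HTuned.toPGL h ^ p = 1 := by
    rw [HTuned.toPGL_eq_map, ← map_pow, ← hord, pow_orderOf_eq_one, map_one]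
  have hquot : ∀ ℓ : ℕ, ℓ.Prime → ∃ Ψ D A : MvPolynomial (Fin 2) K, Ψ * D = A ∧ A ≠ 0 ∧
      (ℓ ≠ p → A * HTuned.Psi φ h p 1 = HTuned.Psi φ h p ℓ) ∧
      algebraMap (MvPolynomial (Fin 2) K) (FractionRing (MvPolynomial (Fin 2) K)) Ψ =
        HTuned.PsiTilde φ h p ℓ ∧
      ∀ (v : Fin 2 → AlgebraicClosure K) (hv : v ≠ 0), aeval v D = 0 →
        HTuned.toPGL h • Projectivization.mk (AlgebraicClosure K) v hv =
          Projectivization.mk _ v hv := by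
    intro ℓ hℓ
    obtain ⟨A, hA, hA0, hmul⟩ := HTuned.exists_mul_Psi_eq φ hd hp hℓ hord hh
    obtain ⟨Ψ, D, hΨD, hΨ, hD⟩ := HTuned.exists_mul_eq_and_eq_PsiTilde φ hA
    exact ⟨Ψ, D, A, hΨD, hA0, hmul, hΨ, hD⟩
  obtain ⟨S, hS, hgood⟩ := HTuned.exists_primes_iterate_eq_pow_smul φ hd hh
  -- The exceptional primes are those in `S`, at most `d + 3`, together with `p` and `2`.
  have hcard : ∀ T : Set ℕ, T ⊆ ((insert 2 (insert p S) : Finset ℕ) : Set ℕ) →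
      T.encard ≤ d + 6 := by
    intro T hT
    refine (Set.encard_le_encard hT).trans ?_
    rw [Set.encard_coe_eq_coe_finsetCard]
    have h1 := Finset.card_insert_le 2 (insert p S)
    have h2 := Finset.card_insert_le p S
    have h3 : (insert 2 (insert p S) : Finset ℕ).card ≤ d + 6 := by omega
    exact_mod_cast h3
  refine ⟨fun ℓ hℓ => ?_, hcard _ fun ℓ hℓ => ?_, hcard _ fun ℓ hℓ => ?_⟩
  · obtain ⟨Ψ, D, A, -, -, -, hΨ, -⟩ := hquot ℓ hℓ
    exact ⟨Ψ, hΨ⟩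
  · obtain ⟨hℓ, c, hc⟩ := hℓ
    by_contra hmem
    rw [Finset.mem_coe, Finset.mem_insert, Finset.mem_insert, not_or, not_or] at hmem
    obtain ⟨h2, hℓp, hℓS⟩ := hmem
    obtain ⟨v, hv, h1, hne⟩ := hgood ℓ hℓ hℓS
    have hprim := fun {n : ℕ} => HTuned.iterate_ne_pow_smul (n := n) (HTuned.toFun_smul φ hh) hp hℓ
      hℓp hH h1 hne
    obtain ⟨Ψ, D, A, hΨD, hA0, hmul, hΨ, hD⟩ := hquot ℓ hℓ
    have hΨc : Ψ = MvPolynomial.C c := IsFractionRing.injective _ _ (hΨ.trans hc)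
    have hΨℓ : aeval v (HTuned.Psi φ h p ℓ) = 0 := by
      have hmem : ℓ % p ∈ Finset.Icc 1 (p - 1) := by
        rw [Finset.mem_Icc]
        have h3 := Nat.mod_lt ℓ hp.pos
        have h4 : ℓ % p ≠ 0 := fun h0 =>
          hℓp ((Nat.prime_dvd_prime_iff_eq hp hℓ).mp (Nat.dvd_of_mod_eq_zero h0)).symm
        omega
      rw [HTuned.Psi, map_prod]
      refine Finset.prod_eq_zero hmem ?_
      rw [← HTuned.toFun_iterate_eq_smul_iff φ ℓ _ hv, h1, HTuned.toPGL_pow,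
        pow_eq_pow_mod ℓ hH]
    have hΨ1 : aeval v (HTuned.Psi φ h p 1) ≠ 0 := by
      rw [HTuned.Psi, map_prod]
      refine Finset.prod_ne_zero_iff.mpr fun j _ h0 => ?_
      rw [← HTuned.toFun_iterate_eq_smul_iff φ 1 _ hv, HTuned.toPGL_pow] at h0
      exact hprim one_pos hℓ.one_lt j h0
    have hAv : aeval v A = 0 := by
      have h3 := congrArg (aeval v) (hmul hℓp)
      rw [map_mul, hΨℓ, mul_eq_zero] at h3
      exact h3.resolve_right hΨ1
    rw [← hΨD, map_mul, mul_eq_zero] at hAv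
    rcases hAv with h3 | h3
    · rw [hΨc, aeval_C, map_eq_zero] at h3
      exact hA0 (by rw [← hΨD, hΨc, h3, map_zero, zero_mul])
    · have hQ := hD v hv h3
      set Q := Projectivization.mk (AlgebraicClosure K) v hv
      have hℓ2 : 2 < ℓ := lt_of_le_of_ne hℓ.two_le (Ne.symm h2)
      have hφQ : HTuned.toPGL h • φ.toFun Q = φ.toFun Q := by rw [← HTuned.toFun_smul φ hh, hQ]
      have hφφQ : HTuned.toPGL h • φ.toFun (φ.toFun Q) = φ.toFun (φ.toFun Q) := by
        rw [← HTuned.toFun_smul φ hh, hφQ]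
      have hne1 : φ.toFun Q ≠ Q := by rwa [hQ] at hne
      have hne2 : φ.toFun (φ.toFun Q) ≠ Q := by
        -- The exponent `0` is allowed in `iterate_ne_pow_smul`, so `φ²(Q) = Q` is excluded as soon
        -- as `2 < ℓ`.
        have h4 := hprim two_pos hℓ2 0
        rwa [pow_zero, one_smul] at h4
      have hQpow : ∀ m : ℕ, HTuned.toPGL h ^ m • Q = Q := by
        intro m
        induction m with
        | zero => simp
        | succ m ih => rw [pow_succ, mul_smul, hQ, ih]
      have hne3 : φ.toFun Q ≠ φ.toFun (φ.toFun Q) := by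
        -- If `φ` fixed `φ(Q)`, then `φ^ℓ(Q) = φ(Q)`; but `φ^ℓ(Q) = h^ℓ(Q) = Q`.
        intro heq
        rw [hQpow, ← Nat.succ_pred_prime hℓ, Function.iterate_succ_apply,
          Function.iterate_fixed heq.symm] at h1
        exact hne1 h1
      have hone := HTuned.mk_eq_one_of_three_fixed_points h hQ hφQ hφφQ hne1.symm hne2.symm hne3
      rw [hone, orderOf_one] at hord
      exact hp.one_lt.ne hord
  · obtain ⟨hℓ, hno⟩ := hℓ
    by_contra hmem
    rw [Finset.mem_coe, Finset.mem_insert, Finset.mem_insert, not_or, not_or] at hmem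
    obtain ⟨-, hℓp, hℓS⟩ := hmem
    obtain ⟨v, hv, h1, hne⟩ := hgood ℓ hℓ hℓS
    -- The exponent `j = ℓ` witnesses the `h`-period; it is prime to `p` because `ℓ ≠ p`.
    refine hno ⟨Projectivization.mk _ v hv, ⟨hℓ.pos, ℓ, hℓ.pos, ?_, h1⟩, ?_⟩
    · exact fun hdvd => hℓp ((Nat.prime_dvd_prime_iff_eq hp hℓ).mp hdvd).symm
    · rintro n ⟨hn, j, -, -, hj⟩
      by_contra hlt
      exact HTuned.iterate_ne_pow_smul (HTuned.toFun_smul φ hh) hp hℓ hℓp hH h1 hne hn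
        (not_le.mp hlt) j hj
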